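/- Let $\gamma>0$ be an ordinal and let $\mathbb P=\langle \mathbb P_\alpha,\tau_\alpha;\ \alpha<\gamma\rangle$ be a finite-support iteration of forcing notions: each $\tau_\alpha$ is a $\mathbb P_\alpha$-name for a poset with a largest element $1_{\tau_\alpha}$, and for every $\alpha\le\gamma$ the conditions of $\mathbb P_\alpha$ are the sequences $p$ of length $\alpha$ of names such that $p\restriction\beta\in\mathbb P_\beta$ and $p\restriction\beta\Vdash p(\beta)\in\tau_\beta$ for all $\beta<\alpha$, and $p(\beta)=1_{\tau_\beta}$ for all but finitely many $\beta<\alpha$, ordered by $p\le q$ iff $p\restriction\beta\Vdash p(\beta)\le q(\beta)$ for all $\beta<\alpha$. Write $\mathbb P$ also for $\mathbb P_\gamma$, and assume that $\mathbb P$ is ccc (every antichain is countable). Suppose that for each $\alpha<\gamma$ there is a poset $\mathbb Q_\alpha$ (in the ground model) such that $$\mathbb P_\alpha\Vdash\text{``if }\check{\mathbb Q}_\alpha\text{ is ccc, then }\tau_\alpha=\check{\mathbb Q}_\alpha\text{, and otherwise }\tau_\alpha\text{ is the trivial (one-element) poset''}.$$ Assume furthermore that $\mathbb P\Vdash\text{``}\check{\mathbb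 Q}_0\text{ is ccc''}$. Then there is a poset $\overline{\mathbb P}$ (which can be taken to be a partial order with a largest element) such that $\mathbb P$ is forcing equivalent to the product $\mathbb Q_0\times\overline{\mathbb P}$, i.e. both embed densely into a common poset. -/

import Mathlib

universe u

/-! ### Notions about a forcing poset in the ground model

A forcing poset is a type `P : Type u` with a reflexive and transitive relation `≤` (partial orders
are included), smaller conditions being stronger. -/

/-- Two conditions are compatible if they have a common extension. -/
def Compat {P : Type u} [Preorder P] (p q : P) : Prop := ∃ r, r ≤ p ∧ r ≤ q

/-- The countable chain condition: every antichain is countable. -/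
def IsCCC (P : Type u) [Preorder P] : Prop :=
  ∀ A : Set P, (∀ p ∈ A, ∀ q ∈ A, p ≠ q → ¬ Compat p q) → A.Countable

/-- Dense embeddings: maps that preserve order and incompatibility and have dense range. -/
structure IsDenseOrderEmbedding {P R : Type u} [Preorder P] [Preorder R] (e : P → R) : Prop where
  mono : ∀ p q, p ≤ q → e p ≤ e q
  incompat : ∀ p q, ¬ Compat p q → ¬ Compat (e p) (e q)
  dense : ∀ r, ∃ p, e p ≤ r

/-- Forcing equivalence: both posets embed densely into a common poset; equivalently, their Boolean
completions are isomorphic. -/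
def ForcingEquiv (P Q : Type u) [Preorder P] [Preorder Q] : Prop :=
  ∃ (R : Type u) (_ : Preorder R) (e : P → R) (f : Q → R), IsDenseOrderEmbedding e ∧ IsDenseOrderEmbedding f

/-! ### Names and the forcing relation -/

/-- `P`-names: sets of pairs (name, condition), the pairs being indexed by a type in `Type u`. -/
inductive PName (P : Type u) : Type (u + 1)
  | mk (I : Type u) (val : I → PName P) (cond : I → P) : PName P

namespace PName

/-- The unordered pair of two names. Here and below an element that is to be present for certain
is paired with every condition, which amounts to pairing it with a largest condition. -/
def upair {P : Type u} (x y : PName P) : PName P :=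
  mk (ULift.{u} Bool × P) (fun i => if i.1.down then x else y) (fun i => i.2)

/-- The (Kuratowski) ordered pair of two names. -/
def opair {P : Type u} (x y : PName P) : PName P :=
  upair (upair x x) (upair x y)

/-- The canonical name of a ground model set. -/
def check (P : Type u) : PSet.{u} → PName P
  | ⟨I, A⟩ => mk (I × P) (fun i => check P (A i.1)) (fun i => i.2)

/-- The canonical name of the range of a family `c` of ground model sets. -/
noncomputable def checkRange (P : Type u) {Q : Type u} (c : Q → ZFSet.{u}) : PName P :=
  mk (Q × P) (fun i => check P (c i.1).out) (fun i => i.2)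

/-- The canonical name of the order `{(c x, c y) | x ≤ y}` on the range of a family `c`. -/
noncomputable def checkOrder (P : Type u) {Q : Type u} [Preorder Q] (c : Q → ZFSet.{u}) : PName P :=
  mk ({x : Q × Q // x.1 ≤ x.2} × P)
    (fun i => opair (check P (c i.1.1.1).out) (check P (c i.1.1.2).out)) (fun i => i.2)

end PName

/-- A statement of the forcing language is represented by the predicate "`p` forces it". -/
abbrev FStmt (P : Type u) : Type u := P → Prop

namespace FStmt

variable {P : Type u} [Preorder P]

/-- `p ⊩ x = y`: whenever `q ≤ p` lies below the condition attached to an element of `x`, densely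
below `q` that element is forced to be equal to an element of `y`; and vice versa. -/
def eq : PName P → PName P → FStmt P
  | ⟨_, x, c⟩, ⟨_, y, d⟩ => fun p =>
    (∀ i, ∀ q ≤ p, q ≤ c i → ∃ r ≤ q, ∃ j, r ≤ d j ∧ eq (x i) (y j) r) ∧
    (∀ j, ∀ q ≤ p, q ≤ d j → ∃ r ≤ q, ∃ i, r ≤ c i ∧ eq (x i) (y j) r)

/-- `p ⊩ x ∈ y`. -/
def mem (x : PName P) : PName P → FStmt P
  | ⟨J, y, d⟩ => fun p => ∀ q ≤ p, ∃ r ≤ q, ∃ j : J, r ≤ d j ∧ eq x (y j) r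

/-- Negation. -/
def not (φ : FStmt P) : FStmt P := fun p => ∀ q ≤ p, ¬ φ q

/-- Conjunction. -/
def and (φ ψ : FStmt P) : FStmt P := fun p => φ p ∧ ψ p

/-- Implication. -/
def imp (φ ψ : FStmt P) : FStmt P := fun p => ∀ q ≤ p, φ q → ψ q

/-- Equivalence. -/
def iff (φ ψ : FStmt P) : FStmt P := and (imp φ ψ) (imp ψ φ)

/-- Universal quantification, in particular over all names. -/
def all {X : Type*} (φ : X → FStmt P) : FStmt P := fun p => ∀ x, φ x p

/-- Existential quantification, in particular over all names. -/
def ex {X : Type*} (φ : X → FStmt P) : FStmt P := fun p => ∀ q ≤ p, ∃ r ≤ q, ∃ x, φ x r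

/-- Universal quantification over the elements of `a`. -/
def ball (a : PName P) (φ : PName P → FStmt P) : FStmt P := all fun x => imp (mem x a) (φ x)

/-- Existential quantification over the elements of `a`. -/
def bex (a : PName P) (φ : PName P → FStmt P) : FStmt P := ex fun x => and (mem x a) (φ x)

/-- `(x, y) ∈ r`. -/
def rel (r x y : PName P) : FStmt P := mem (PName.opair x y) r

/-- `a` is countable: there is an injective function from `a` to `ω`. -/
def countable (a : PName P) : FStmt P :=
  ex fun f : PName P =>
    and (ball a fun x => bex (PName.check P PSet.omega) fun n => rel f x n)
      (ball a fun x => ball a fun y =>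
        ball (PName.check P PSet.omega) fun n => ball (PName.check P PSet.omega) fun m =>
          imp (rel f x n) (imp (rel f y m) (iff (eq x y) (eq n m))))

/-- `a` is an antichain of the poset `(t, r)`. -/
def antichain (t r a : PName P) : FStmt P :=
  and (ball a fun x => mem x t)
    (ball a fun x => ball a fun y =>
      imp (not (eq x y)) (not (bex t fun z => and (rel r z x) (rel r z y))))

/-- The poset `(t, r)` is ccc. -/
def ccc (t r : PName P) : FStmt P :=
  all fun a : PName P => imp (antichain t r a) (countable a)

/-- `r` is a reflexive and transitive relation on `t` with largest element `o ∈ t`. -/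
def poset (t r o : PName P) : FStmt P :=
  and (and (mem o t) (ball t fun x => rel r x o))
    (and (ball t fun x => rel r x x)
      (ball t fun x => ball t fun y => ball t fun z =>
        imp (rel r x y) (imp (rel r y z) (rel r x z))))

/-- `(t, r)` and `(t', r')` are the same poset. -/
def samePoset (t r t' r' : PName P) : FStmt P :=
  and (eq t t') (ball t fun x => ball t fun y => iff (rel r x y) (rel r' x y))

/-- `t` has exactly one element. -/
def singleton (t : PName P) : FStmt P := bex t fun x => ball t fun y => eq y x

end FStmt

/-- `P ⊩ φ`: every condition forces `φ`. -/
def Forced {P : Type u} (φ : FStmt P) : Prop := ∀ p, φ p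

/-- `p ⊩ "the ground model poset Q is ccc"`, where the elements of `Q` are the sets `c x`. -/
noncomputable def FStmt.checkCCC {P Q : Type u} [Preorder P] [Preorder Q] (c : Q → ZFSet.{u}) : FStmt P :=
  FStmt.ccc (PName.checkRange P c) (PName.checkOrder P c)

/-! ### Finite-support iterations -/

/-- Restriction to stage `b` of a sequence of length `a`. -/
def restrictSeq {ι : Type u} [LinearOrder ι] {C : ι → Type u} {a b : WithTop ι} (h : b ≤ a)
    (p : ∀ j : {j : ι // (j : WithTop ι) < a}, C j) :
    ∀ j : {j : ι // (j : WithTop ι) < b}, C j :=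
  fun j => p ⟨j.1, j.2.trans_le h⟩

/-- A finite-support iteration `⟨P_j, τ_j ; j ∈ ι⟩` along a well-order `ι`, which plays the role of
the ordinal length `γ`. The stages `P_a` are indexed by `a : WithTop ι`; the stage `⊤` is the whole
iteration (`P_γ`). A condition in `P_a` is a sequence of length `a` whose `j`-th coordinate is an
element of `Coord j`, an index set for a collection of `P_j`-names. That collection may be
the domain of the name `τ_j`, or all `P_j`-names for elements of `τ_j` up to equivalence, or
anything in between: it only has to exhaust `τ_j` in the sense of `exhaust`. -/
structure FSIteration (ι : Type u) [LinearOrder ι] [WellFoundedLT ι] where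
  /-- Indices for the names allowed as `j`-th coordinates. -/
  Coord : ι → Type u
  /-- The index of the largest element of the `j`-th iterand. -/
  one : ∀ j, Coord j
  /-- The conditions of the stage `P_a`. -/
  Cond : ∀ a : WithTop ι, Set (∀ j : {j : ι // (j : WithTop ι) < a}, Coord j)
  /-- The order of the stage `P_a`. -/
  [order : ∀ a, Preorder (Cond a)]
  /-- The `P_j`-name `τ_j` for (the underlying set of) the `j`-th iterand. -/
  name : ∀ j : ι, PName (Cond j)
  /-- The `P_j`-name for the order of the `j`-th iterand. -/
  ord : ∀ j : ι, PName (Cond j)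
  /-- The names allowed as `j`-th coordinates. -/
  val : ∀ j : ι, Coord j → PName (Cond j)
  /-- `P_j` forces the `j`-th iterand to be a poset with largest element. -/
  poset : ∀ j, Forced (FStmt.poset (name j) (ord j) (val j (one j)))
  /-- `P_j` forces each element of `τ_j` to be one of the names allowed as `j`-th coordinates. -/
  exhaust : ∀ j, Forced (FStmt.ball (name j) fun x => FStmt.ex fun s => FStmt.eq x (val j s))
  /-- `p` is in `P_a` iff it has finite support and, for each `j < a`, `p ↾ j` is in `P_j` and
  forces `p j` to be in `τ_j`. -/
  mem_cond_iff : ∀ a p, p ∈ Cond a ↔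
    {j | p j ≠ one j}.Finite ∧
    ∀ j : {j : ι // (j : WithTop ι) < a}, ∃ h : restrictSeq j.2.le p ∈ Cond j.1,
      FStmt.mem (val j (p j)) (name j) ⟨restrictSeq j.2.le p, h⟩
  /-- `p ≤ q` iff, for each `j < a`, `p ↾ j` forces `p j ≤ q j`. -/
  le_iff : ∀ a (p q : Cond a), p ≤ q ↔
    ∀ j : {j : ι // (j : WithTop ι) < a}, ∃ h : restrictSeq j.2.le p.1 ∈ Cond j.1,
      FStmt.rel (ord j) (val j (p.1 j)) (val j (q.1 j)) ⟨restrictSeq j.2.le p.1, h⟩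

namespace FSIteration

/-- The stage `P_a`, as a type. -/
abbrev Stage {ι : Type u} [LinearOrder ι] [WellFoundedLT ι] (I : FSIteration ι)
    (a : WithTop ι) : Type u := I.Cond a

instance {ι : Type u} [LinearOrder ι] [WellFoundedLT ι] (I : FSIteration ι) (a : WithTop ι) :
    Preorder (I.Stage a) := I.order a

/-- The `j`-th iterand of `I` is the ground model poset `Q` (with elements `c x`) if that poset is
ccc in the extension by `P_j`, and it is trivial otherwise. -/
def UsesIfCCC {ι : Type u} [LinearOrder ι] [WellFoundedLT ι] (I : FSIteration ι) (j : ι)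
    {Q : Type u} [Preorder Q] (c : Q → ZFSet.{u}) : Prop :=
  Forced (P := I.Stage j) <| FStmt.and
    (FStmt.imp (FStmt.checkCCC c)
      (FStmt.samePoset (I.name j) (I.ord j) (PName.checkRange _ c) (PName.checkOrder _ c)))
    (FStmt.imp (FStmt.not (FStmt.checkCCC c)) (FStmt.singleton (I.name j)))

end FSIteration

/-!
The product of a ccc poset `P` with a poset that `P` forces to be ccc is ccc: from an antichain
of the product one reads off a `P`-name for an antichain of the second factor. Hence `P × Q ⊥` is
ccc. On the other hand `p` forces `Q j` to be ccc as soon as the product of `Q j` with the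
conditions below `p` is ccc.

By well-founded induction along the finite supports, the conditions that decide each of their
coordinates to be an element of the ground model (or the largest element `1`) are dense. So `P_a` is
equivalent to a ground model poset of finite sequences `s`, where `s j` may differ from `1` only if
`s ↾ j` forces `Q j` to be ccc.

Whether `s ↾ j` forces this does not depend on `s ⊥`: moving the first coordinates of
conditions into the second factor of `P × Q ⊥` makes room for an arbitrary new first coordinate in
the first factor, so that the product of `Q j` with the conditions below a modification of `s ↾ j`
maps to `P × Q ⊥` by a map that preserves incompatibility. Therefore the first coordinate splits
off.
-/

/-! ### The countable chain condition and forcing equivalence -/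

section CCC

variable {P : Type u} [Preorder P]

theorem Compat.refl (p : P) : Compat p p := ⟨p, le_rfl, le_rfl⟩

theorem Compat.symm {p q : P} : Compat p q → Compat q p := fun ⟨r, hp, hq⟩ => ⟨r, hq, hp⟩

theorem Compat.mono {p p' q q' : P} (hp : p ≤ p') (hq : q ≤ q') : Compat p q → Compat p' q' :=
  fun ⟨r, hrp, hrq⟩ => ⟨r, hrp.trans hp, hrq.trans hq⟩

theorem IsCCC.countable_of_map (hP : IsCCC P) {α : Type*} (v : α → P)
    (hv : ∀ a b, Compat (v a) (v b) → a = b) : Countable α := by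
  have hinj : Function.Injective v := fun a b hab => hv a b (hab ▸ Compat.refl (v a))
  have hrange : (Set.range v).Countable := by
    refine hP _ ?_
    rintro _ ⟨a, rfl⟩ _ ⟨b, rfl⟩ hne hab
    exact hne (congrArg v (hv a b hab))
  exact Set.countable_univ_iff.1
    (Set.countable_of_injective_of_countable_image hinj.injOn (Set.image_univ ▸ hrange))

theorem IsCCC.of_reflects_compat (hP : IsCCC P) {X : Type u} [Preorder X] (v : X → P)
    (hv : ∀ a b, Compat (v a) (v b) → Compat a b) : IsCCC X := by
  intro A hA
  refine Set.countable_coe_iff.1 (hP.countable_of_map (fun a : A => v a) fun a b hab => ?_)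
  by_contra hne
  exact hA a a.2 b b.2 (Subtype.coe_ne_coe.2 hne) (hv _ _ hab)

theorem IsCCC.of_prod_right {X : Type u} [Preorder X] [Nonempty P] (h : IsCCC (P × X)) :
    IsCCC X :=
  h.of_reflects_compat (fun x => (Classical.arbitrary P, x)) fun _ _ ⟨r, hx, hy⟩ =>
    ⟨r.2, hx.2, hy.2⟩

theorem IsCCC.exists_countable_predense (hP : IsCCC P) {U : Set P}
    (hU : ∀ p, ∃ r ≤ p, r ∈ U) : ∃ W ⊆ U, W.Countable ∧ ∀ p, ∃ w ∈ W, Compat p w := by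
  obtain ⟨W, hW⟩ := zorn_subset {W : Set P | W ⊆ U ∧ W.Pairwise fun p q => ¬ Compat p q}
    fun K hK hchain => ⟨⋃₀ K, ⟨Set.sUnion_subset fun W hW => (hK hW).1,
      (Set.pairwise_sUnion hchain.directedOn).2 fun W hW => (hK hW).2⟩,
      fun W hW => Set.subset_sUnion_of_mem hW⟩
  refine ⟨W, hW.prop.1, hP W fun p hp q hq => hW.prop.2 hp hq, fun p => ?_⟩
  obtain ⟨r, hrp, hrU⟩ := hU p
  by_contra! hno
  have hrW : ∀ w ∈ W, ¬ Compat r w := fun w hw hrw => hno w hw (hrw.mono hrp le_rfl)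
  have hinsert : insert r W ⊆ W := hW.le_of_ge
    ⟨Set.insert_subset hrU hW.prop.1, hW.prop.2.insert fun w hw _ =>
      ⟨hrW w hw, fun hwr => hrW w hw hwr.symm⟩⟩ (Set.subset_insert r W)
  exact hrW r (hinsert (Set.mem_insert r W)) (Compat.refl r)

end CCC

section ForcingEquiv

variable {P Q R D X : Type u} [Preorder P] [Preorder Q] [Preorder R] [Preorder D] [Preorder X]

theorem IsDenseOrderEmbedding.compat_of_compat {e : P → R} (he : IsDenseOrderEmbedding e) {p q : P}
    (h : Compat (e p) (e q)) : Compat p q :=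
  not_imp_not.1 (he.incompat p q) h

theorem IsDenseOrderEmbedding.comp {f : Q → R} {e : P → Q} (hf : IsDenseOrderEmbedding f)
    (he : IsDenseOrderEmbedding e) : IsDenseOrderEmbedding (f ∘ e) where
  mono p q h := hf.mono _ _ (he.mono p q h)
  incompat p q h := hf.incompat _ _ (he.incompat p q h)
  dense r := by
    obtain ⟨q, hq⟩ := hf.dense r
    obtain ⟨p, hp⟩ := he.dense q
    exact ⟨p, (hf.mono _ _ hp).trans hq⟩

theorem ForcingEquiv.comp_right (h : ForcingEquiv P D) {e : Q → D} (he : IsDenseOrderEmbedding e) :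
    ForcingEquiv P Q := by
  obtain ⟨R, _, f, g, hf, hg⟩ := h
  exact ⟨R, _, f, g ∘ e, hf, hg.comp he⟩

theorem ForcingEquiv.isCCC_prod (h : ForcingEquiv P D) (hP : IsCCC (P × X)) : IsCCC (D × X) := by
  obtain ⟨R, _, f, g, hf, hg⟩ := h
  choose v hv using fun d => hf.dense (g d)
  refine hP.of_reflects_compat (fun i => (v i.1, i.2)) ?_
  rintro i j ⟨⟨p, x⟩, hi, hj⟩
  obtain ⟨d, hdi, hdj⟩ := hg.compat_of_compat
    ⟨f p, (hf.mono _ _ hi.1).trans (hv i.1), (hf.mono _ _ hj.1).trans (hv j.1)⟩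
  exact ⟨(d, x), ⟨hdi, hi.2⟩, ⟨hdj, hj.2⟩⟩

/-- The nonempty lower sets of `D`, with `U ≤ V` if `V` is dense in `U`. It stands in for the
Boolean completion of any poset into which `D` embeds densely. -/
def DenseLowerSet (D : Type u) [Preorder D] : Type u := {U : LowerSet D // (U : Set D).Nonempty}

namespace DenseLowerSet

instance : Preorder (DenseLowerSet D) where
  le U V := ∀ d ∈ U.1, ∃ d' ≤ d, d' ∈ V.1
  le_refl _ d hd := ⟨d, le_rfl, hd⟩
  le_trans U V W hUV hVW d hd := by
    obtain ⟨d', hd', hV⟩ := hUV d hd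
    obtain ⟨d'', hd'', hW⟩ := hVW d' hV
    exact ⟨d'', hd''.trans hd', hW⟩

variable {i : D → P} (hi : IsDenseOrderEmbedding i)

/-- The embedding of `P` into the lower sets of a poset `D` that embeds densely into `P`. -/
def ofDense (p : P) : DenseLowerSet D :=
  ⟨⟨{d | i d ≤ p}, fun _ _ h hd => (hi.mono _ _ h).trans hd⟩, hi.dense p⟩

theorem isDenseOrderEmbedding_ofDense : IsDenseOrderEmbedding (ofDense hi) where
  mono _ _ h d hd := ⟨d, le_rfl, le_trans (α := P) hd h⟩
  incompat p q := by
    rw [not_imp_not]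
    rintro ⟨U, hp, hq⟩
    obtain ⟨d, hd⟩ := U.2
    obtain ⟨d', hd', hdp⟩ := hp d hd
    obtain ⟨d'', hd'', hdq⟩ := hq d' (U.1.lower hd' hd)
    exact ⟨i d'', (hi.mono _ _ hd'').trans hdp, hdq⟩
  dense U := by
    obtain ⟨d, hd⟩ := U.2
    refine ⟨i d, fun d' hd' => ?_⟩
    obtain ⟨e, he', he⟩ := hi.compat_of_compat ⟨i d', le_rfl, hd'⟩
    exact ⟨e, he', U.1.lower he hd⟩

end DenseLowerSet

theorem ForcingEquiv.of_isDenseOrderEmbedding {e : D → P} {f : D → Q}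
    (he : IsDenseOrderEmbedding e) (hf : IsDenseOrderEmbedding f) : ForcingEquiv P Q :=
  ⟨DenseLowerSet D, inferInstance, _, _, DenseLowerSet.isDenseOrderEmbedding_ofDense he,
    DenseLowerSet.isDenseOrderEmbedding_ofDense hf⟩

theorem IsDenseOrderEmbedding.of_le_of_le {e : P → R} (he : Monotone e) (g : R → P)
    (hg : ∀ r p, r ≤ e p → g r ≤ p) (heg : ∀ r, e (g r) ≤ r) : IsDenseOrderEmbedding e where
  mono _ _ h := he h
  incompat p q := not_imp_not.2 fun ⟨r, hp, hq⟩ => ⟨g r, hg r p hp, hg r q hq⟩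
  dense r := ⟨g r, heg r⟩

theorem isDenseOrderEmbedding_ofAntisymmetrization (T : Type u) [Preorder T] :
    IsDenseOrderEmbedding (ofAntisymmetrization (α := T) (· ≤ ·)) := by
  refine .of_le_of_le (fun _ _ => ofAntisymmetrization_le_ofAntisymmetrization_iff.2)
    (toAntisymmetrization (· ≤ ·)) (fun r p h => ?_) (fun r => ?_)
  · exact (toAntisymmetrization_mono h).trans_eq (toAntisymmetrization_ofAntisymmetrization _ p)
  · exact toAntisymmetrization_le_toAntisymmetrization_iff.1
      (toAntisymmetrization_ofAntisymmetrization ..).le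

theorem IsDenseOrderEmbedding.prodMap_id {e : P → R} (he : IsDenseOrderEmbedding e) (X : Type u)
    [Preorder X] : IsDenseOrderEmbedding (Prod.map id e : X × P → X × R) where
  mono _ _ h := ⟨h.1, he.mono _ _ h.2⟩
  incompat i j := not_imp_not.2 fun ⟨r, hi, hj⟩ => by
    obtain ⟨p, hpi, hpj⟩ := he.compat_of_compat ⟨r.2, hi.2, hj.2⟩
    exact ⟨(r.1, p), ⟨hi.1, hpi⟩, ⟨hj.1, hpj⟩⟩
  dense r := by
    obtain ⟨p, hp⟩ := he.dense r.2
    exact ⟨(r.1, p), le_rfl, hp⟩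

end ForcingEquiv

/-! ### The forcing relation -/

namespace FStmt

section Language

variable {P : Type u} [Preorder P] {x x' y y' z : PName P} {p q : P}

theorem eq.mono (h : eq x y p) (hq : q ≤ p) : eq x y q := by
  cases x; cases y
  simp only [eq] at h ⊢
  exact ⟨fun i r hr => h.1 i r (hr.trans hq), fun j r hr => h.2 j r (hr.trans hq)⟩

theorem eq_of_dense (h : ∀ q ≤ p, ∃ r ≤ q, eq x y r) : eq x y p := by
  cases x; cases y
  simp only [eq] at h ⊢
  constructor
  · intro i q hq hi
    obtain ⟨r, hr, h, -⟩ := h q hq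
    obtain ⟨r', hr', hj⟩ := h i r le_rfl (hr.trans hi)
    exact ⟨r', hr'.trans hr, hj⟩
  · intro j q hq hj
    obtain ⟨r, hr, -, h⟩ := h q hq
    obtain ⟨r', hr', hi⟩ := h j r le_rfl (hr.trans hj)
    exact ⟨r', hr'.trans hr, hi⟩

theorem eq.refl (x : PName P) (p : P) : eq x x p := by
  induction x generalizing p with
  | mk I x c ih =>
    simp only [eq]
    exact ⟨fun i q _ hi => ⟨q, le_rfl, i, hi, ih i q⟩, fun i q _ hi => ⟨q, le_rfl, i, hi, ih i q⟩⟩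

theorem eq.symm (h : eq x y p) : eq y x p := by
  induction x generalizing y p with
  | mk I x c ih =>
    cases y
    simp only [eq] at h ⊢
    constructor
    · intro j q hq hj
      obtain ⟨r, hr, i, hi, hij⟩ := h.2 j q hq hj
      exact ⟨r, hr, i, hi, ih i hij⟩
    · intro i q hq hi
      obtain ⟨r, hr, j, hj, hij⟩ := h.1 i q hq hi
      exact ⟨r, hr, j, hj, ih i hij⟩

theorem eq.trans (h : eq x y p) (h' : eq y z p) : eq x z p := by
  induction x generalizing y z p with
  | mk I x c ih =>
    cases y; cases z
    simp only [eq] at h h' ⊢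
    constructor
    · intro i q hq hi
      obtain ⟨r, hr, j, hj, hij⟩ := h.1 i q hq hi
      obtain ⟨r', hr', k, hk, hjk⟩ := h'.1 j r (hr.trans hq) hj
      exact ⟨r', hr'.trans hr, k, hk, ih i (hij.mono hr') hjk⟩
    · intro k q hq hk
      obtain ⟨r, hr, j, hj, hjk⟩ := h'.2 k q hq hk
      obtain ⟨r', hr', i, hi, hij⟩ := h.2 j r (hr.trans hq) hj
      exact ⟨r', hr'.trans hr, i, hi, ih i hij (hjk.mono hr')⟩

theorem mem.mono (h : mem x y p) (hq : q ≤ p) : mem x y q := by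
  cases y
  exact fun r hr => h r (hr.trans hq)

theorem mem_of_dense (h : ∀ q ≤ p, ∃ r ≤ q, mem x y r) : mem x y p := by
  cases y
  intro q hq
  obtain ⟨r, hr, h⟩ := h q hq
  obtain ⟨r', hr', h⟩ := h r le_rfl
  exact ⟨r', hr'.trans hr, h⟩

theorem mem.congr_left (h : mem x y p) (hx : eq x x' p) : mem x' y p := by
  cases y
  intro q hq
  obtain ⟨r, hr, j, hj, h⟩ := h q hq
  exact ⟨r, hr, j, hj, (hx.mono (hr.trans hq)).symm.trans h⟩

theorem mem.congr_right (h : mem x y p) (hy : eq y y' p) : mem x y' p := by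
  cases y; cases y'
  simp only [eq] at hy
  intro q hq
  obtain ⟨r, hr, j, hj, h⟩ := h q hq
  obtain ⟨r', hr', k, hk, h'⟩ := hy.1 j r (hr.trans hq) hj
  exact ⟨r', hr'.trans hr, k, hk, (h.mono hr').trans h'⟩

theorem mem_upair_left (x y : PName P) (p : P) : mem x (PName.upair x y) p :=
  fun q _ => ⟨q, le_rfl, (⟨true⟩, q), le_rfl, by simpa using eq.refl x q⟩

theorem mem_upair_right (x y : PName P) (p : P) : mem y (PName.upair x y) p :=
  fun q _ => ⟨q, le_rfl, (⟨false⟩, q), le_rfl, by simpa using eq.refl y q⟩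

theorem eq_or_eq_of_mem_upair (h : mem z (PName.upair x y) p) :
    ∃ r ≤ p, eq z x r ∨ eq z y r := by
  obtain ⟨r, hr, ⟨⟨b⟩, _⟩, -, h⟩ := h p le_rfl
  cases b
  · exact ⟨r, hr, .inr (by simpa using h)⟩
  · exact ⟨r, hr, .inl (by simpa using h)⟩

theorem upair_congr (hx : eq x x' p) (hy : eq y y' p) :
    eq (PName.upair x y) (PName.upair x' y') p := by
  simp only [PName.upair, eq]
  constructor <;>
  · rintro ⟨⟨b⟩, r⟩ q hq hi
    refine ⟨q, le_rfl, (⟨b⟩, r), hi, ?_⟩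
    cases b
    · simpa using hy.mono hq
    · simpa using hx.mono hq

theorem opair_congr (hx : eq x x' p) (hy : eq y y' p) :
    eq (PName.opair x y) (PName.opair x' y') p :=
  upair_congr (upair_congr hx hx) (upair_congr hx hy)

theorem upair_comm (x y : PName P) (p : P) : eq (PName.upair x y) (PName.upair y x) p := by
  simp only [PName.upair, eq]
  constructor <;>
  · rintro ⟨⟨b⟩, r⟩ q - hi
    exact ⟨q, le_rfl, (⟨!b⟩, r), hi, by cases b <;> simpa using eq.refl _ q⟩

theorem exists_eq_of_upair_eq_of_eq (h : eq (PName.upair x y) (PName.upair x' y') p)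
    (hx : eq x x' p) : ∃ r ≤ p, eq y y' r := by
  obtain ⟨r, hr, hyx' | hyy'⟩ := eq_or_eq_of_mem_upair ((mem_upair_right x y p).congr_right h)
  · obtain ⟨s, hs, hy'x | hy'y⟩ :=
      eq_or_eq_of_mem_upair ((mem_upair_right x' y' r).congr_right (h.mono hr).symm)
    · exact ⟨s, hs.trans hr,
        (hyx'.mono hs).trans ((hx.mono (hs.trans hr)).symm.trans hy'x.symm)⟩
    · exact ⟨s, hs.trans hr, hy'y.symm⟩
  · exact ⟨r, hr, hyy'⟩

theorem exists_of_upair_eq (h : eq (PName.upair x y) (PName.upair x' y') p) :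
    ∃ r ≤ p, (eq x x' r ∧ eq y y' r) ∨ (eq x y' r ∧ eq y x' r) := by
  obtain ⟨r, hr, hx | hx⟩ := eq_or_eq_of_mem_upair ((mem_upair_left x y p).congr_right h)
  · obtain ⟨s, hs, hy⟩ := exists_eq_of_upair_eq_of_eq (h.mono hr) hx
    exact ⟨s, hs.trans hr, .inl ⟨hx.mono hs, hy⟩⟩
  · obtain ⟨s, hs, hy⟩ :=
      exists_eq_of_upair_eq_of_eq ((h.mono hr).trans (upair_comm x' y' r)) hx
    exact ⟨s, hs.trans hr, .inr ⟨hx.mono hs, hy⟩⟩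

theorem exists_of_opair_eq (h : eq (PName.opair x y) (PName.opair x' y') p) :
    ∃ r ≤ p, eq x x' r ∧ eq y y' r := by
  obtain ⟨r, hr, ⟨h₁, h₂⟩ | ⟨h₁, h₂⟩⟩ := exists_of_upair_eq h
  · obtain ⟨s, hs, h₁⟩ := exists_of_upair_eq h₁
    have hx : eq x x' s := by rcases h₁ with h₁ | h₁ <;> exact h₁.1
    obtain ⟨t, ht, hy⟩ := exists_eq_of_upair_eq_of_eq (h₂.mono hs) hx
    exact ⟨t, ht.trans (hs.trans hr), hx.mono ht, hy⟩
  · obtain ⟨s, hs, h₁⟩ := exists_of_upair_eq h₁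
    have hx : eq x x' s ∧ eq x y' s := by rcases h₁ with h₁ | h₁ <;> [exact h₁; exact h₁.symm]
    obtain ⟨t, ht, h₂⟩ := exists_of_upair_eq (h₂.mono hs)
    have hy : eq y x' t := by rcases h₂ with h₂ | h₂ <;> exact h₂.2
    exact ⟨t, ht.trans (hs.trans hr), hx.1.mono ht,
      hy.trans ((hx.1.symm.trans hx.2).mono ht)⟩

theorem opair_eq_iff :
    eq (PName.opair x y) (PName.opair x' y') p ↔ eq x x' p ∧ eq y y' p := by
  refine ⟨fun h => ?_, fun h => opair_congr h.1 h.2⟩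
  have dense : ∀ q ≤ p, ∃ r ≤ q, eq x x' r ∧ eq y y' r :=
    fun q hq => exists_of_opair_eq (h.mono hq)
  exact ⟨eq_of_dense fun q hq => (dense q hq).imp fun _ h => ⟨h.1, h.2.1⟩,
    eq_of_dense fun q hq => (dense q hq).imp fun _ h => ⟨h.1, h.2.2⟩⟩

variable {t r : PName P}

theorem rel.mono (h : rel r x y p) (hq : q ≤ p) : rel r x y q :=
  mem.mono h hq

theorem rel.congr (h : rel r x y p) (hx : eq x x' p) (hy : eq y y' p) : rel r x' y' p :=
  mem.congr_left h (opair_congr hx hy)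

theorem ball.mono {φ : PName P → FStmt P} (h : ball t φ p) (hq : q ≤ p) : ball t φ q :=
  fun x s hs => h x s (hs.trans hq)

/-- Compatibility of two elements of the poset `(t, r)`, as a statement of the forcing language. -/
def compat (t r x y : PName P) : FStmt P := bex t fun z => and (rel r z x) (rel r z y)

theorem compat.mono (h : compat t r x y p) (hq : q ≤ p) : compat t r x y q :=
  fun s hs => h s (hs.trans hq)

theorem compat.congr (h : compat t r x y p) (hx : eq x x' p) (hy : eq y y' p) :
    compat t r x' y' p := by
  intro q hq
  obtain ⟨s, hs, z, hz, hzx, hzy⟩ := h q hq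
  exact ⟨s, hs, z, hz, hzx.congr (eq.refl z s) (hx.mono (hs.trans hq)),
    hzy.congr (eq.refl z s) (hy.mono (hs.trans hq))⟩

end Language

section Poset

variable {P : Type u} [Preorder P] {t r o x y z : PName P} {p : P}

theorem poset.top_mem (h : poset t r o p) : mem o t p := h.1.1

theorem poset.rel_top (h : poset t r o p) (hx : mem x t p) : rel r x o p := h.1.2 x p le_rfl hx

theorem poset.rel_refl (h : poset t r o p) (hx : mem x t p) : rel r x x p := h.2.1 x p le_rfl hx

theorem poset.rel_trans (h : poset t r o p) (hx : mem x t p) (hy : mem y t p) (hz : mem z t p)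
    (hxy : rel r x y p) (hyz : rel r y z p) : rel r x z p :=
  h.2.2 x p le_rfl hx y p le_rfl hy z p le_rfl hz p le_rfl hxy p le_rfl hyz

end Poset

section Check

variable {P : Type u} [Preorder P] {p : P}

theorem equiv_of_check_eq {a b : PSet.{u}} (h : eq (PName.check P a) (PName.check P b) p) :
    a.Equiv b := by
  induction a generalizing b p with
  | mk I A ih =>
    cases b
    simp only [PName.check, eq] at h
    constructor
    · intro i
      obtain ⟨_, -, j, -, hij⟩ := h.1 (i, p) p le_rfl le_rfl
      exact ⟨j.1, ih i hij⟩
    · intro j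
      obtain ⟨_, -, i, -, hij⟩ := h.2 (j, p) p le_rfl le_rfl
      exact ⟨i.1, ih i.1 hij⟩

theorem rank_ofNat (n : ℕ) : (PSet.ofNat.{u} n).rank = n := by
  induction n with
  | zero => simp [PSet.ofNat]
  | succ n ih => simp [PSet.ofNat, PSet.rank_insert, ih]

/-- The canonical name of the natural number `n`. -/
def natName (P : Type u) (n : ℕ) : PName P := PName.check P (PSet.ofNat n)

theorem eq_of_natName_eq {m n : ℕ} (h : eq (natName P m) (natName P n) p) : m = n := by
  have hrank := PSet.rank_congr (equiv_of_check_eq h)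
  rw [rank_ofNat, rank_ofNat] at hrank
  exact_mod_cast hrank

theorem natName_mem_omega (n : ℕ) (p : P) : mem (natName P n) (PName.check P PSet.omega) p :=
  fun q _ => ⟨q, le_rfl, (⟨n⟩, q), le_rfl, eq.refl _ q⟩

theorem exists_natName_of_mem_omega {x : PName P} (h : mem x (PName.check P PSet.omega.{u}) p) :
    ∃ r ≤ p, ∃ n : ℕ, eq x (natName P n) r := by
  obtain ⟨r, hr, ⟨⟨n⟩, _⟩, -, h⟩ := h p le_rfl
  exact ⟨r, hr, n, h⟩

variable {Q : Type u}

/-- The canonical name of the element `x` of a ground model poset whose elements are represented by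
the sets `c x`. -/
noncomputable def checkElem (P : Type u) (c : Q → ZFSet.{u}) (x : Q) : PName P :=
  PName.check P (c x).out

theorem eq_of_checkElem_eq (c : Q ↪ ZFSet.{u}) {x y : Q}
    (h : eq (checkElem P c x) (checkElem P c y) p) : x = y := by
  apply c.injective
  rw [← Quotient.out_eq (c x), ← Quotient.out_eq (c y)]
  exact Quotient.sound (equiv_of_check_eq h)

theorem checkElem_mem (c : Q → ZFSet.{u}) (x : Q) (p : P) :
    mem (checkElem P c x) (PName.checkRange P c) p :=
  fun q _ => ⟨q, le_rfl, (x, q), le_rfl, eq.refl _ q⟩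

theorem exists_checkElem_of_mem {c : Q → ZFSet.{u}} {x : PName P}
    (h : mem x (PName.checkRange P c) p) : ∃ r ≤ p, ∃ y, eq x (checkElem P c y) r := by
  obtain ⟨r, hr, ⟨y, _⟩, -, h⟩ := h p le_rfl
  exact ⟨r, hr, y, h⟩

variable [Preorder Q]

theorem rel_checkElem (c : Q → ZFSet.{u}) {x y : Q} (h : x ≤ y) (p : P) :
    rel (PName.checkOrder P c) (checkElem P c x) (checkElem P c y) p :=
  fun q _ => ⟨q, le_rfl, (⟨(x, y), h⟩, q), le_rfl, eq.refl _ q⟩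

theorem le_of_rel_checkElem (c : Q ↪ ZFSet.{u}) {x y : Q}
    (h : rel (PName.checkOrder P c) (checkElem P c x) (checkElem P c y) p) : x ≤ y := by
  obtain ⟨r, -, ⟨⟨⟨x', y'⟩, hxy⟩, _⟩, -, h⟩ := h p le_rfl
  obtain ⟨hx, hy⟩ := opair_eq_iff.1 h
  obtain rfl := eq_of_checkElem_eq c hx
  obtain rfl := eq_of_checkElem_eq c hy
  exact hxy

theorem compat_checkElem_iff (c : Q ↪ ZFSet.{u}) {x y : Q} :
    compat (PName.checkRange P c) (PName.checkOrder P c) (checkElem P c x) (checkElem P c y) p ↔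
      Compat x y := by
  constructor
  · intro h
    obtain ⟨r, -, z, hz, hzx, hzy⟩ := h p le_rfl
    obtain ⟨s, hs, z₀, hz₀⟩ := exists_checkElem_of_mem hz
    exact ⟨z₀, le_of_rel_checkElem c ((hzx.mono hs).congr hz₀ (eq.refl _ s)),
      le_of_rel_checkElem c ((hzy.mono hs).congr hz₀ (eq.refl _ s))⟩
  · rintro ⟨z, hzx, hzy⟩ q -
    exact ⟨q, le_rfl, checkElem P c z, checkElem_mem c z q, rel_checkElem c hzx q,
      rel_checkElem c hzy q⟩

end Check

/-! ### Forcing the countable chain condition -/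

section Injection

variable {P : Type u} [Preorder P] {a f x y : PName P} {p q : P}

/-- `f` is an injective function from `a` to `ω`; thus `countable a` is `ex (isInjection a)`. -/
def isInjection (a f : PName P) : FStmt P :=
  and (ball a fun x => bex (PName.check P PSet.omega) fun n => rel f x n)
    (ball a fun x => ball a fun y =>
      ball (PName.check P PSet.omega) fun n => ball (PName.check P PSet.omega) fun m =>
        imp (rel f x n) (imp (rel f y m) (iff (eq x y) (eq n m))))

theorem isInjection.mono (h : isInjection a f p) (hq : q ≤ p) : isInjection a f q :=
  ⟨h.1.mono hq, h.2.mono hq⟩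

theorem isInjection.exists_rel (h : isInjection a f p) (hx : mem x a p) :
    ∃ r ≤ p, ∃ k, rel f x (natName P k) r := by
  obtain ⟨q, hq, n, hn, hxn⟩ := h.1 x p le_rfl hx p le_rfl
  obtain ⟨r, hr, k, hk⟩ := exists_natName_of_mem_omega hn
  exact ⟨r, hr.trans hq, k, (hxn.mono hr).congr (eq.refl x r) hk⟩

theorem isInjection.eq_of_rel (h : isInjection a f p) {k : ℕ} (hx : mem x a p) (hy : mem y a p)
    (hxk : rel f x (natName P k) p) (hyk : rel f y (natName P k) p) : eq x y p :=
  (h.2 x p le_rfl hx y p le_rfl hy _ p le_rfl (natName_mem_omega k p) _ p le_rfl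
    (natName_mem_omega k p) p le_rfl hxk p le_rfl hyk).2 p le_rfl (eq.refl _ p)

theorem antichain.eq_of_compat {t r : PName P} (h : antichain t r a p) (hx : mem x a p)
    (hy : mem y a p) (hxy : compat t r x y p) : ∃ q ≤ p, eq x y q := by
  by_contra! hne
  exact h.2 x p le_rfl hx y p le_rfl hy p le_rfl hne p le_rfl hxy

end Injection

theorem checkCCC_mono {P Q : Type u} [Preorder P] [Preorder Q] {c : Q → ZFSet.{u}} {p q : P}
    (h : checkCCC c p) (hq : q ≤ p) : checkCCC c q :=
  fun a s hs => h a s (hs.trans hq)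

section Product

variable {P Q : Type u} [Preorder P] (c : Q ↪ ZFSet.{u})

/-- A subset `A` of `P × Q` induces the name of the set of all `y` such that some `(r, y) ∈ A` has
`r` in the generic filter. -/
noncomputable def sliceName (c : Q → ZFSet.{u}) (A : Set (P × Q)) : PName P :=
  .mk A (fun i => checkElem P c i.1.2) fun i => i.1.1

theorem mem_sliceName {A : Set (P × Q)} {i : P × Q} (hi : i ∈ A) {p : P} (hp : p ≤ i.1) :
    mem (checkElem P c i.2) (sliceName c A) p :=
  fun q hq => ⟨q, le_rfl, ⟨i, hi⟩, hq.trans hp, eq.refl _ q⟩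

theorem exists_of_mem_sliceName {A : Set (P × Q)} {x : PName P} {p : P}
    (h : mem x (sliceName c A) p) : ∃ r ≤ p, ∃ i ∈ A, r ≤ i.1 ∧ eq x (checkElem P c i.2) r := by
  obtain ⟨r, hr, i, hi, h⟩ := h p le_rfl
  exact ⟨r, hr, i.1, i.2, hi, h⟩

/-- The function `g` on the subset `E` of a ground model poset, as a name. -/
noncomputable def graphName (P : Type u) (c : Q → ZFSet.{u}) (E : Set Q) (g : Q → ℕ) : PName P :=
  .mk (E × P) (fun i => .opair (checkElem P c i.1) (natName P (g i.1))) fun i => i.2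

variable {E : Set Q} {g : Q → ℕ} {p : P}

theorem rel_graphName {x : Q} (hx : x ∈ E) (p : P) :
    rel (graphName P c E g) (checkElem P c x) (natName P (g x)) p :=
  fun q _ => ⟨q, le_rfl, (⟨x, hx⟩, q), le_rfl, eq.refl _ q⟩

theorem exists_of_rel_graphName {x n : PName P} (h : rel (graphName P c E g) x n p) :
    ∃ q ≤ p, ∃ y ∈ E, eq x (checkElem P c y) q ∧ eq n (natName P (g y)) q := by
  obtain ⟨q, hq, ⟨y, _⟩, -, h⟩ := h p le_rfl
  exact ⟨q, hq, y.1, y.2, opair_eq_iff.1 h⟩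

theorem eq_iff_eq_of_rel_graphName (hg : Set.InjOn g E) {x y n m : PName P}
    (hx : rel (graphName P c E g) x n p) (hy : rel (graphName P c E g) y m p) :
    eq x y p ↔ eq n m p := by
  have dense : ∀ q ≤ p, ∃ r ≤ q, ∃ x₀ ∈ E, ∃ y₀ ∈ E, eq x (checkElem P c x₀) r ∧
      eq n (natName P (g x₀)) r ∧ eq y (checkElem P c y₀) r ∧ eq m (natName P (g y₀)) r := by
    intro q hq
    obtain ⟨r, hr, x₀, hx₀, hxr, hnr⟩ := exists_of_rel_graphName c (hx.mono hq)
    obtain ⟨s, hs, y₀, hy₀, hys, hms⟩ := exists_of_rel_graphName c (hy.mono (hr.trans hq))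
    exact ⟨s, hs.trans hr, x₀, hx₀, y₀, hy₀, hxr.mono hs, hnr.mono hs, hys, hms⟩
  constructor <;> intro h <;> refine eq_of_dense fun q hq => ?_ <;>
    obtain ⟨r, hr, x₀, hx₀, y₀, hy₀, hxr, hnr, hyr, hmr⟩ := dense q hq <;>
    have h := h.mono (hr.trans hq)
  · obtain rfl := eq_of_checkElem_eq c (hxr.symm.trans (h.trans hyr))
    exact ⟨r, hr, hnr.trans hmr.symm⟩
  · obtain rfl := hg hx₀ hy₀ (eq_of_natName_eq (hnr.symm.trans (h.trans hmr)))
    exact ⟨r, hr, hxr.trans hyr.symm⟩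

theorem countable_of_forall_mem (hE : E.Countable) {a : PName P}
    (ha : ball a (fun x => mem x (PName.checkRange P c)) p)
    (haE : ∀ x, ∀ q ≤ p, mem (checkElem P c x) a q → x ∈ E) : countable a p := by
  obtain ⟨g, hg⟩ := Set.countable_iff_exists_injOn.1 hE
  refine fun q hq => ⟨q, le_rfl, graphName P c E g, ?_, ?_⟩
  · intro x r hr hx s hs
    obtain ⟨s', hs', y, hy⟩ :=
      exists_checkElem_of_mem (ha x s (hs.trans (hr.trans hq)) (hx.mono hs))
    have hyE : y ∈ E :=
      haE y s' (hs'.trans (hs.trans (hr.trans hq))) ((hx.mono (hs'.trans hs)).congr_left hy)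
    exact ⟨s', hs', natName P (g y), natName_mem_omega _ _,
      (rel_graphName c hyE s').congr hy.symm (eq.refl _ s')⟩
  · intro x _ _ _ y _ _ _ n _ _ _ m _ _ _ r _ hxn s hs hym
    exact ⟨fun t ht => (eq_iff_eq_of_rel_graphName c hg (hxn.mono (ht.trans hs)) (hym.mono ht)).1,
      fun t ht => (eq_iff_eq_of_rel_graphName c hg (hxn.mono (ht.trans hs)) (hym.mono ht)).2⟩

variable [Preorder Q]

theorem antichain_sliceName {A : Set (P × Q)} (hA : ∀ i ∈ A, ∀ j ∈ A, i ≠ j → ¬ Compat i j)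
    (p : P) : antichain (PName.checkRange P c) (PName.checkOrder P c) (sliceName c A) p := by
  refine ⟨fun x q _ hx => mem_of_dense fun s hs => ?_,
    fun x q _ hx y q₁ hq₁ hy q₂ hq₂ hne s hs hxy => ?_⟩
  · obtain ⟨r, hr, i, -, -, hxi⟩ := exists_of_mem_sliceName c (hx.mono hs)
    exact ⟨r, hr, (checkElem_mem c i.2 r).congr_left hxi.symm⟩
  · obtain ⟨r, hrs, i, hi, hri, hxi⟩ :=
      exists_of_mem_sliceName c (hx.mono (hs.trans (hq₂.trans hq₁)))
    obtain ⟨r', hr', j, hj, hrj, hyj⟩ :=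
      exists_of_mem_sliceName c (hy.mono (hrs.trans (hs.trans hq₂)))
    have hij : i ≠ j := by
      rintro rfl
      exact hne r' (hr'.trans (hrs.trans hs)) ((hxi.mono hr').trans hyj.symm)
    obtain ⟨z, hzi, hzj⟩ := (compat_checkElem_iff c).1
      (compat.congr (compat.mono hxy (hr'.trans hrs)) (hxi.mono hr') hyj)
    exact hA i hi j hj hij ⟨(r', z), ⟨hr'.trans hri, hzi⟩, ⟨hrj, hzj⟩⟩

theorem countable_setOf_rel_sliceName (hP : IsCCC P) {A : Set (P × Q)}
    (hA : ∀ i ∈ A, ∀ j ∈ A, i ≠ j → ¬ Compat i j) (f : PName P) (k : ℕ) :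
    {i ∈ A | ∃ r ≤ i.1, isInjection (sliceName c A) f r ∧
      rel f (checkElem P c i.2) (natName P k) r}.Countable := by
  refine Set.countable_coe_iff.1 (hP.countable_of_map (fun i => i.2.2.choose) ?_)
  intro i j ⟨s, hsi, hsj⟩
  obtain ⟨hi, hri, hf, hik⟩ := And.intro i.2.1 i.2.2.choose_spec
  obtain ⟨hj, hrj, -, hjk⟩ := And.intro j.2.1 j.2.2.choose_spec
  have hij : i.1.2 = j.1.2 := eq_of_checkElem_eq c <| (hf.mono hsi).eq_of_rel
    (mem_sliceName c hi (hsi.trans hri)) (mem_sliceName c hj (hsj.trans hrj))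
    (hik.mono hsi) (hjk.mono hsj)
  by_contra hne
  exact hA i hi j hj (Subtype.coe_ne_coe.2 hne)
    ⟨(s, i.1.2), ⟨hsi.trans hri, le_rfl⟩, ⟨hsj.trans hrj, hij.le⟩⟩

theorem isCCC_prod_of_forced (hP : IsCCC P) (h : Forced (P := P) (checkCCC c)) :
    IsCCC (P × Q) := by
  intro A hA
  obtain ⟨W, hWf, hWc, hW⟩ := hP.exists_countable_predense
    (U := {w | ∃ f, isInjection (sliceName c A) f w})
    fun p => h p _ p le_rfl (antichain_sliceName c hA p) p le_rfl
  choose f hf using hWf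
  refine (hWc.biUnion fun w hw => Set.countable_iUnion fun k =>
    countable_setOf_rel_sliceName c hP hA (f hw) k).mono fun i hi => ?_
  obtain ⟨w, hw, r, hri, hrw⟩ := hW i.1
  obtain ⟨s, hs, k, hk⟩ := ((hf hw).mono hrw).exists_rel (mem_sliceName c hi hri)
  exact Set.mem_iUnion₂.2 ⟨w, hw, Set.mem_iUnion.2
    ⟨k, hi, s, hs.trans hri, (hf hw).mono (hs.trans hrw), hk⟩⟩

theorem countable_setOf_possible_mem (h : IsCCC (Set.Iic p × Q)) {a : PName P}
    (ha : antichain (PName.checkRange P c) (PName.checkOrder P c) a p) :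
    {x | ∃ r ≤ p, mem (checkElem P c x) a r}.Countable := by
  refine Set.countable_coe_iff.1
    (h.countable_of_map (fun x => (⟨x.2.choose, x.2.choose_spec.1⟩, x.1)) ?_)
  rintro ⟨x, hx⟩ ⟨y, hy⟩ ⟨⟨r, z⟩, ⟨hrx, hzx⟩, ⟨hry, hzy⟩⟩
  have hxr := hx.choose_spec.2.mono hrx
  have hyr := hy.choose_spec.2.mono hry
  have har : antichain _ _ a r.1 := ⟨ha.1.mono r.2, ha.2.mono r.2⟩
  obtain ⟨s, -, hxy⟩ := har.eq_of_compat hxr hyr ((compat_checkElem_iff c).2 ⟨z, hzx, hzy⟩)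
  exact Subtype.ext (eq_of_checkElem_eq c hxy)

theorem checkCCC_of_isCCC_prod (h : IsCCC (Set.Iic p × Q)) : checkCCC c p := by
  intro a q hq ha
  have hq' : IsCCC (Set.Iic q × Q) :=
    h.of_reflects_compat (fun i => (⟨i.1, i.1.2.trans hq⟩, i.2)) ?_
  · exact countable_of_forall_mem c (countable_setOf_possible_mem c hq' ha) ha.1
      fun x r hr hx => ⟨r, hr, hx⟩
  · rintro i j ⟨⟨r, z⟩, hi, hj⟩
    exact ⟨(⟨r, le_trans (b := i.1.1) hi.1 i.1.2⟩, z), hi, hj⟩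

end Product

end FStmt

/-! ### Stages of an iteration -/

section Sequences

variable {ι : Type u} [LinearOrder ι]

theorem exists_last_or_forall_not {a : WithTop ι} {p : ι → Prop}
    (h : {j : ι | (j : WithTop ι) < a ∧ p j}.Finite) :
    (∃ j : ι, (j : WithTop ι) < a ∧ p j ∧ ∀ i : ι, j < i → (i : WithTop ι) < a → ¬ p i) ∨
      ∀ j : ι, (j : WithTop ι) < a → ¬ p j := by
  obtain hempty | hne := Set.eq_empty_or_nonempty {j : ι | (j : WithTop ι) < a ∧ p j}
  · exact .inr fun j hj hpj => hempty.le ⟨hj, hpj⟩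
  · obtain ⟨j, hj, hmax⟩ := Set.exists_max_image _ id h hne
    exact .inl ⟨j, hj.1, hj.2, fun i hji hi hpi => (hmax i ⟨hi, hpi⟩).not_gt hji⟩

variable {β : ι → Type u}

/-- The initial segment of length `a` of a sequence of full length. -/
def initialSegment (f : ∀ i, β i) (a : WithTop ι) : ∀ j : {j : ι // (j : WithTop ι) < a}, β j :=
  fun j => f j

/-- The sequence that agrees with `f` below `j`, has the value `y` at `j`, and agrees with `d`
above `j`. -/
def splice (d f : ∀ i, β i) (j : ι) (y : β j) : ∀ i, β i :=
  Function.update (fun i => if i < j then f i else d i) j y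

variable (d f : ∀ i, β i) (j : ι) (y : β j)

theorem splice_of_lt {i : ι} (h : i < j) : splice d f j y i = f i := by
  simp [splice, Function.update_of_ne h.ne, h]

theorem splice_self : splice d f j y j = y := by simp [splice]

theorem splice_of_gt {i : ι} (h : j < i) : splice d f j y i = d i := by
  simp [splice, Function.update_of_ne h.ne', h.not_gt]

variable {d f j y}

theorem finite_splice_ne (h : {i | i < j ∧ f i ≠ d i}.Finite) :
    {i | splice d f j y i ≠ d i}.Finite := by
  refine (h.insert j).subset fun i hi => ?_
  rcases lt_trichotomy i j with hij | rfl | hij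
  · exact .inr ⟨hij, by simpa [splice_of_lt d f j y hij] using hi⟩
  · exact .inl rfl
  · exact absurd (splice_of_gt d f j y hij) hi

end Sequences

namespace FSIteration

open FStmt

variable {ι : Type u} [LinearOrder ι] [WellFoundedLT ι]

section Stages

variable {I : FSIteration ι} {a b : WithTop ι} {j : ι}

/-- The restriction `p ↾ b` of a condition. -/
def restrict (h : b ≤ a) (p : I.Stage a) : I.Stage b := by
  refine ⟨restrictSeq h p.1, (I.mem_cond_iff b _).2 ⟨?_, fun j =>
    ((I.mem_cond_iff a p.1).1 p.2).2 ⟨j.1, j.2.trans_le h⟩⟩⟩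
  exact ((I.mem_cond_iff a p.1).1 p.2).1.preimage
    (f := fun j : {j : ι // (j : WithTop ι) < b} => ⟨j.1, j.2.trans_le h⟩)
    fun i _ j _ hij => Subtype.ext (by simpa using hij)

/-- The name `p(j)`. -/
def coordName (p : I.Stage a) (hj : (j : WithTop ι) < a) : PName (I.Stage j) :=
  I.val j (p.1 ⟨j, hj⟩)

theorem coordName_mem (p : I.Stage a) (hj : (j : WithTop ι) < a) :
    mem (coordName p hj) (I.name j) (restrict hj.le p) :=
  (((I.mem_cond_iff a p.1).1 p.2).2 ⟨j, hj⟩).2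

theorem restrict_mono (h : b ≤ a) {p q : I.Stage a} (hpq : p ≤ q) :
    restrict h p ≤ restrict h q :=
  (I.le_iff b _ _).2 fun j => (I.le_iff a p q).1 hpq ⟨j.1, j.2.trans_le h⟩

/-- `x` and `y` belong to the `j`-th iterand, where `x ≤ y`. -/
def iterandLE (I : FSIteration ι) {j : ι} (x y : PName (I.Stage j)) : FStmt (I.Stage j) :=
  and (mem x (I.name j)) (and (mem y (I.name j)) (rel (I.ord j) x y))

variable {x y z : PName (I.Stage j)} {p q : I.Stage j}

theorem iterandLE.mono (h : I.iterandLE x y p) (hq : q ≤ p) : I.iterandLE x y q :=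
  ⟨h.1.mono hq, h.2.1.mono hq, h.2.2.mono hq⟩

theorem iterandLE.trans (h : I.iterandLE x y p) (h' : I.iterandLE y z p) : I.iterandLE x z p :=
  ⟨h.1, h'.2.1, (I.poset j p).rel_trans h.1 h.2.1 h'.2.1 h.2.2 h'.2.2⟩

theorem iterandLE.of_eq (hx : mem x (I.name j) p) (hxy : eq x y p) : I.iterandLE x y p :=
  ⟨hx, hx.congr_left hxy, ((I.poset j p).rel_refl hx).congr (eq.refl x p) hxy⟩

theorem iterandLE.refl (hx : mem x (I.name j) p) : I.iterandLE x x p := .of_eq hx (eq.refl x p)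

theorem iterandLE_one (hx : mem x (I.name j) p) : I.iterandLE x (I.val j (I.one j)) p :=
  ⟨hx, (I.poset j p).top_mem, (I.poset j p).rel_top hx⟩

theorem le_iff_iterandLE {p q : I.Stage a} : p ≤ q ↔ ∀ (j : ι) (hj : (j : WithTop ι) < a),
    I.iterandLE (coordName p hj) (coordName q hj) (restrict hj.le p) := by
  refine (I.le_iff a p q).trans
    ⟨fun h j hj => ?_, fun h j => ⟨(restrict j.2.le p).2, (h j j.2).2.2⟩⟩
  exact ⟨coordName_mem p hj, (coordName_mem q hj).mono
    (restrict_mono hj.le ((I.le_iff a p q).2 h)), (h ⟨j, hj⟩).2⟩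

theorem mem_cond_of_forall_mem (f : ∀ i, I.Coord i) (hf : {i | f i ≠ I.one i}.Finite)
    (h : ∀ (i : ι) (hi : initialSegment f i ∈ I.Cond i),
      mem (I.val i (f i)) (I.name i) ⟨initialSegment f i, hi⟩) (a : WithTop ι) :
    initialSegment f a ∈ I.Cond a := by
  induction a using WellFoundedLT.induction with
  | ind a ih =>
    exact (I.mem_cond_iff a _).2 ⟨hf.preimage Subtype.val_injective.injOn,
      fun i => ⟨ih i i.2, h i (ih i i.2)⟩⟩

instance (I : FSIteration ι) (a : WithTop ι) : Nonempty (I.Stage a) :=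
  ⟨initialSegment I.one a,
    mem_cond_of_forall_mem I.one (by simp) (fun i _ => (I.poset i _).top_mem) a⟩

/-- The prolongation of a condition by largest elements to a sequence of full length. -/
def pad (p : I.Stage a) (i : ι) : I.Coord i :=
  open Classical in if h : (i : WithTop ι) < a then p.1 ⟨i, h⟩ else I.one i

theorem pad_of_lt (p : I.Stage a) {i : ι} (h : (i : WithTop ι) < a) : pad p i = p.1 ⟨i, h⟩ :=
  dif_pos h

theorem pad_of_not_lt (p : I.Stage a) {i : ι} (h : ¬ (i : WithTop ι) < a) : pad p i = I.one i :=
  dif_neg h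

theorem finite_pad_ne (p : I.Stage a) : {i | pad p i ≠ I.one i}.Finite := by
  refine (((I.mem_cond_iff a p.1).1 p.2).1.image Subtype.val).subset fun i hi => ?_
  by_cases h : (i : WithTop ι) < a
  · exact ⟨⟨i, h⟩, by simpa [pad_of_lt p h] using hi, rfl⟩
  · exact absurd (pad_of_not_lt p h) hi

section Extend

variable (p) {y : I.Coord j}

theorem update_pad_mem_cond (hy : mem (I.val j y) (I.name j) p) (a : WithTop ι) :
    initialSegment (Function.update (pad p) j y) a ∈ I.Cond a := by
  have hlt : ∀ {i : ι} (h : i < j),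
      Function.update (pad p) j y i = p.1 ⟨i, WithTop.coe_lt_coe.2 h⟩ :=
    fun {i} h => by rw [Function.update_of_ne h.ne, pad_of_lt]
  refine mem_cond_of_forall_mem _ ?_ (fun i hi => ?_) a
  · refine ((finite_pad_ne p).insert j).subset fun i hi => ?_
    by_cases hij : i = j
    · exact .inl hij
    · exact .inr (by simpa [Function.update_of_ne hij] using hi)
  rcases lt_trichotomy i j with hij | rfl | hij
  · have hres : (⟨_, hi⟩ : I.Stage i) = restrict (WithTop.coe_lt_coe.2 hij).le p :=
      Subtype.ext (funext fun k => hlt ((WithTop.coe_lt_coe.1 k.2).trans hij))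
    rw [hres, hlt hij]
    exact coordName_mem p _
  · have hres : (⟨_, hi⟩ : I.Stage i) = p :=
      Subtype.ext (funext fun k => hlt (WithTop.coe_lt_coe.1 k.2))
    rw [hres, Function.update_self]
    exact hy
  · rw [Function.update_of_ne hij.ne', pad_of_not_lt p (WithTop.coe_lt_coe.not.2 hij.not_gt)]
    exact (I.poset i _).top_mem

variable (hy : mem (I.val j y) (I.name j) p)

/-- The condition `p ⌢ y ⌢ (1, 1, …)` of length `a`, where `p` has length `j`. -/
def extend (a : WithTop ι) : I.Stage a :=
  ⟨initialSegment (Function.update (pad p) j y) a, update_pad_mem_cond p hy a⟩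

theorem restrict_extend (hja : (j : WithTop ι) ≤ a) : restrict hja (extend p hy a) = p := by
  refine Subtype.ext (funext fun k => ?_)
  change Function.update (pad p) j y k.1 = _
  rw [Function.update_of_ne (WithTop.coe_lt_coe.1 k.2).ne, pad_of_lt p k.2]

theorem coordName_extend_self (hj : (j : WithTop ι) < a) :
    coordName (extend p hy a) hj = I.val j y :=
  congrArg (I.val j) (Function.update_self ..)

theorem coordName_extend_of_gt {i : ι} (hi : (i : WithTop ι) < a) (hij : j < i) :
    coordName (extend p hy a) hi = I.val i (I.one i) := by
  refine congrArg (I.val i) ((Function.update_of_ne hij.ne' ..).trans ?_)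
  exact pad_of_not_lt p (WithTop.coe_lt_coe.not.2 hij.not_gt)

variable {p}

theorem extend_le {q : I.Stage a} (hj : (j : WithTop ι) < a) (hpq : p ≤ restrict hj.le q)
    (hyq : I.iterandLE (I.val j y) (coordName q hj) p)
    (hq : ∀ (i : ι) (hi : (i : WithTop ι) < a), j < i → q.1 ⟨i, hi⟩ = I.one i) :
    extend p hy a ≤ q := by
  have hres := restrict_extend p hy hj.le
  refine le_iff_iterandLE.2 fun i hi => ?_
  rcases lt_trichotomy i j with hij | rfl | hij
  · exact le_iff_iterandLE.1 (hres.trans_le hpq) i (WithTop.coe_lt_coe.2 hij)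
  · rw [coordName_extend_self, hres]
    exact hyq
  · have hone : coordName q hi = I.val i (I.one i) := congrArg (I.val i) (hq i hi hij)
    rw [hone]
    exact iterandLE_one (coordName_mem _ hi)

end Extend

end Stages

/-! ### Deciding coordinates in the ground model -/

section LeBelow

variable {ι : Type u} [LinearOrder ι] {Q : ι → Type u} [∀ j, Preorder (Q j)] {a b : WithTop ι}
  {s t v : ∀ j, WithTop (Q j)}

/-- The coordinatewise order of sequences, below stage `a`. -/
def LeBelow (a : WithTop ι) (s t : ∀ j, WithTop (Q j)) : Prop :=
  ∀ j : ι, (j : WithTop ι) < a → s j ≤ t j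

theorem LeBelow.trans (h : LeBelow a s t) (h' : LeBelow a t v) :
    LeBelow a s v :=
  fun j hj => (h j hj).trans (h' j hj)

theorem LeBelow.mono (h : LeBelow a s t) (hb : b ≤ a) : LeBelow b s t :=
  fun j hj => h j (hj.trans_le hb)

theorem LeBelow.update_of_update {j : ι} {w w' : WithTop (Q j)}
    (h : LeBelow a s (Function.update t j w)) (hw : w' ≤ t j) :
    LeBelow a (Function.update s j w') t := by
  intro i hi
  obtain rfl | hij := eq_or_ne i j
  · rwa [Function.update_self]
  · simpa only [Function.update_of_ne hij] using h i hi

theorem LeBelow.of_splice {j : ι} {w : WithTop (Q j)} (h : LeBelow ⊤ s (splice v t j w)) :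
    LeBelow j s t := fun i hi =>
  (h i (WithTop.coe_lt_top i)).trans_eq (splice_of_lt _ _ _ _ (WithTop.coe_lt_coe.1 hi))

end LeBelow

variable {ι : Type u} [LinearOrder ι] [WellFoundedLT ι] {I : FSIteration ι}

section Iterand

variable {j : ι} {Q : Type u} {c : Q ↪ ZFSet.{u}} {p q : I.Stage j}

/-- The canonical name of the element `w` of the `j`-th iterand, where `⊤` stands for its largest
element `1`; the values in `Q` are meant only where `Q` is ccc. -/
noncomputable def valueName (I : FSIteration ι) (j : ι) (c : Q → ZFSet.{u}) (w : WithTop Q) :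
    PName (I.Stage j) :=
  w.recTopCoe (I.val j (I.one j)) (checkElem _ c)

variable [Preorder Q] {x y : PName (I.Stage j)} {w w' : WithTop Q}

theorem valueName_mem (hQ : I.UsesIfCCC j c) (hw : w ≠ ⊤ → checkCCC c p) :
    mem (I.valueName j c w) (I.name j) p := by
  induction w with
  | top => exact (I.poset j p).top_mem
  | coe x =>
    exact (checkElem_mem c x p).congr_right
      ((hQ p).1 p le_rfl (hw (WithTop.coe_ne_top))).1.symm

theorem rel_ord_checkElem_iff (hQ : I.UsesIfCCC j c) (hp : checkCCC c p) {x y : Q} :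
    rel (I.ord j) (checkElem _ c x) (checkElem _ c y) p ↔ x ≤ y := by
  have hsame := (hQ p).1 p le_rfl hp
  have hmem : ∀ x : Q, mem (checkElem _ c x) (I.name j) p :=
    fun x => (checkElem_mem c x p).congr_right hsame.1.symm
  have hiff := hsame.2 _ p le_rfl (hmem x) _ p le_rfl (hmem y)
  exact ⟨fun h => le_of_rel_checkElem c (hiff.1 p le_rfl h),
    fun h => hiff.2 p le_rfl (rel_checkElem c h p)⟩

theorem valueName_mono (hQ : I.UsesIfCCC j c) (hww' : w ≤ w') (hw : w ≠ ⊤ → checkCCC c p) :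
    I.iterandLE (I.valueName j c w) (I.valueName j c w') p := by
  have hmem := valueName_mem hQ hw
  induction w' with
  | top => exact iterandLE_one hmem
  | coe y =>
    obtain ⟨x, rfl, hxy⟩ := WithTop.le_coe_iff.1 hww'
    have hp := hw WithTop.coe_ne_top
    exact ⟨hmem, valueName_mem hQ fun _ => hp,
      (rel_ord_checkElem_iff hQ hp).2 hxy⟩

theorem le_of_iterandLE_valueName (hQ : I.UsesIfCCC j c) (hp : checkCCC c p) (hw : w ≠ ⊤)
    (h : I.iterandLE (I.valueName j c w) (I.valueName j c w') p) : w ≤ w' := by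
  obtain ⟨x, rfl⟩ := WithTop.ne_top_iff_exists.1 hw
  induction w' with
  | top => exact le_top
  | coe y => exact WithTop.coe_le_coe.2 ((rel_ord_checkElem_iff hQ hp).1 h.2.2)

/-- `p` decides the element `x` of the `j`-th iterand to be equivalent to `w`. As the iterand is
merely preordered, equality would be too much to ask for. -/
structure Decides (c : Q → ZFSet.{u}) (p : I.Stage j) (x : PName (I.Stage j)) (w : WithTop Q) :
    Prop where
  ccc : w ≠ ⊤ → checkCCC c p
  le : I.iterandLE x (I.valueName j c w) p
  ge : I.iterandLE (I.valueName j c w) x p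

theorem Decides.mono (h : Decides c p x w) (hq : q ≤ p) : Decides c q x w :=
  ⟨fun hw => checkCCC_mono (h.ccc hw) hq, h.le.mono hq, h.ge.mono hq⟩

theorem decides_one (c : Q → ZFSet.{u}) (p : I.Stage j) : Decides c p (I.val j (I.one j)) ⊤ :=
  ⟨fun h => absurd rfl h, .refl (I.poset j p).top_mem, .refl (I.poset j p).top_mem⟩

theorem decides_of_eq_valueName (hx : mem x (I.name j) p) (hw : w ≠ ⊤ → checkCCC c p)
    (hxw : eq x (I.valueName j c w) p) : Decides c p x w :=
  ⟨hw, .of_eq hx hxw, .of_eq (hx.congr_left hxw) hxw.symm⟩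

theorem Decides.iterandLE (hQ : I.UsesIfCCC j c) (hx : Decides c p x w) (hy : Decides c p y w')
    (h : w ≤ w') : I.iterandLE x y p :=
  (hx.le.trans (valueName_mono hQ h hx.ccc)).trans hy.ge

theorem Decides.le_of_iterandLE (hQ : I.UsesIfCCC j c) (hx : Decides c p x w)
    (hy : Decides c p y w') (h : I.iterandLE x y p) (hw : w ≠ ⊤) : w ≤ w' :=
  le_of_iterandLE_valueName hQ (hx.ccc hw) hw ((hx.ge.trans h).trans hy.le)

theorem Decides.of_top (hx : Decides c p x ⊤) (hy : Decides c p y w)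
    (h : I.iterandLE x y p) : Decides c p x w :=
  ⟨hy.ccc, h.trans hy.le, (iterandLE_one hy.ge.1).trans hx.ge⟩

theorem exists_decides (hQ : I.UsesIfCCC j c) (hx : mem x (I.name j) p) :
    ∃ q ≤ p, ∃ w, Decides c q x w := by
  by_cases hp : ∃ q ≤ p, checkCCC c q
  · obtain ⟨q, hq, hc⟩ := hp
    obtain ⟨r, hr, y, hy⟩ :=
      exists_checkElem_of_mem ((hx.mono hq).congr_right ((hQ q).1 q le_rfl hc).1)
    exact ⟨r, hr.trans hq, y, decides_of_eq_valueName (hx.mono (hr.trans hq))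
      (fun _ => checkCCC_mono hc hr) hy⟩
  · push Not at hp
    obtain ⟨q, hq, z, -, hz⟩ := (hQ p).2 p le_rfl hp p le_rfl
    have hxz : eq x z q := hz x q le_rfl (hx.mono hq)
    have honez : eq (I.val j (I.one j)) z q := hz _ q le_rfl (I.poset j q).top_mem
    exact ⟨q, hq, ⊤, decides_of_eq_valueName (hx.mono hq) (fun h => absurd rfl h)
      (hxz.trans honez.symm)⟩

theorem exists_coord_decides (hQ : I.UsesIfCCC j c) (hw : w ≠ ⊤ → checkCCC c p) :
    ∃ q ≤ p, ∃ y, Decides c q (I.val j y) w := by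
  have hmem := valueName_mem hQ hw
  obtain ⟨q, hq, y, hy⟩ := I.exhaust j p _ p le_rfl hmem p le_rfl
  exact ⟨q, hq, y, decides_of_eq_valueName ((hmem.mono hq).congr_left hy)
    (fun h => checkCCC_mono (hw h) hq) hy.symm⟩

end Iterand

section Realization

variable {Q : ι → Type u} [∀ j, Preorder (Q j)] {c : ∀ j, Q j ↪ ZFSet.{u}} {a b : WithTop ι}
  {s t : ∀ j, WithTop (Q j)}

/-- The condition `p` is, up to equivalence, the finite sequence `s` of ground model elements:
each `p ↾ j` decides `p(j)` to be `s j`. Values of `s` from `a` on are irrelevant. -/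
structure Realizes (c : ∀ j, Q j ↪ ZFSet.{u}) (p : I.Stage a) (s : ∀ j, WithTop (Q j)) :
    Prop where
  finite : {j : ι | (j : WithTop ι) < a ∧ s j ≠ ⊤}.Finite
  decides : ∀ (j : ι) (hj : (j : WithTop ι) < a),
    Decides (c j) (restrict hj.le p) (coordName p hj) (s j)

variable {p q : I.Stage a}

theorem Realizes.restrict (h : Realizes c p s) (hb : b ≤ a) : Realizes c (restrict hb p) s :=
  ⟨h.finite.subset fun _ hj => ⟨hj.1.trans_le hb, hj.2⟩,
    fun j hj => h.decides j (hj.trans_le hb)⟩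

theorem Realizes.le (hQ : ∀ j, I.UsesIfCCC j (c j)) (hp : Realizes c p s) (hq : Realizes c q t)
    (hst : LeBelow a s t) : p ≤ q := by
  induction a using WellFoundedLT.induction with
  | ind a ih =>
    refine le_iff_iterandLE.2 fun j hj => ?_
    have hle := ih j hj (hp.restrict hj.le) (hq.restrict hj.le) (hst.mono hj.le)
    exact (hp.decides j hj).iterandLE (hQ j) ((hq.decides j hj).mono hle) (hst j hj)

/-- Where the iterand is trivial, `p(j)` may be decided to be `1` and lie below any `t j`; hence `s`
may have to be changed. -/
theorem Realizes.exists_le (hQ : ∀ j, I.UsesIfCCC j (c j)) (hp : Realizes c p s)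
    (hq : Realizes c q t) (hpq : p ≤ q) :
    ∃ v, Realizes c p v ∧ LeBelow a v s ∧ LeBelow a v t := by
  classical
  refine ⟨fun j => if s j = ⊤ then t j else s j, ⟨?_, fun j hj => ?_⟩, fun j _ => ?_,
    fun j hj => ?_⟩
  · refine (hp.finite.union hq.finite).subset fun j hj => ?_
    by_cases hs : s j = ⊤
    · exact .inr ⟨hj.1, by simpa only [Set.mem_ofPred_eq, hs, if_pos] using hj.2⟩
    · exact .inl ⟨hj.1, hs⟩
  · have hle := le_iff_iterandLE.1 hpq j hj
    have htj := (hq.decides j hj).mono (restrict_mono hj.le hpq)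
    split_ifs with hs
    · exact (hs ▸ hp.decides j hj).of_top htj hle
    · exact hp.decides j hj
  · change (if s j = ⊤ then t j else s j) ≤ s j
    split_ifs with hs
    · exact hs ▸ le_top
    · exact le_rfl
  · have hle := le_iff_iterandLE.1 hpq j hj
    have htj := (hq.decides j hj).mono (restrict_mono hj.le hpq)
    change (if s j = ⊤ then t j else s j) ≤ t j
    split_ifs with hs
    · exact le_rfl
    · exact (hp.decides j hj).le_of_iterandLE (hQ j) htj hle hs

theorem Realizes.extend {j : ι} {p : I.Stage j} (hp : Realizes c p s) {y : I.Coord j}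
    {w : WithTop (Q j)} (hy : Decides (c j) p (I.val j y) w) (hja : (j : WithTop ι) < a) :
    Realizes c (extend p hy.le.1 a) (splice (fun _ => ⊤) s j w) := by
  have hfin : {i | i < j ∧ s i ≠ ⊤}.Finite :=
    hp.finite.subset fun i hi => ⟨WithTop.coe_lt_coe.2 hi.1, hi.2⟩
  refine ⟨(finite_splice_ne hfin).subset fun i hi => hi.2, fun i hi => ?_⟩
  rcases lt_trichotomy i j with hij | rfl | hij
  · have hdecides : ∀ q : I.Stage a, FSIteration.restrict hja.le q = p →
        Decides (c i) (FSIteration.restrict hi.le q) (coordName q hi) (s i) := by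
      rintro q rfl
      exact hp.decides i (WithTop.coe_lt_coe.2 hij)
    rw [splice_of_lt _ _ _ _ hij]
    exact hdecides _ (restrict_extend p hy.le.1 hja.le)
  · rw [splice_self, coordName_extend_self, restrict_extend]
    exact hy
  · rw [splice_of_gt _ _ _ _ hij, coordName_extend_of_gt p hy.le.1 hi hij]
    exact decides_one _ _

theorem exists_realizes_le (hQ : ∀ j, I.UsesIfCCC j (c j)) (p : I.Stage a) :
    ∃ q ≤ p, ∃ s, Realizes c q s := by
  induction a using WellFoundedLT.induction with
  | ind a ih =>
    obtain ⟨j, hj, -, hlast⟩ | hone := exists_last_or_forall_not (p := fun i => pad p i ≠ I.one i)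
      ((finite_pad_ne p).subset fun i hi => hi.2)
    · obtain ⟨q, hq, w, hw⟩ := exists_decides (hQ j) (coordName_mem p hj)
      obtain ⟨r, hr, s, hs⟩ := ih j hj q
      refine ⟨extend r (hw.mono hr).le.1 a, extend_le _ hj (hr.trans hq) ?_ fun i hi hji => ?_, _,
        hs.extend (hw.mono hr) hj⟩
      · exact .refl (hw.mono hr).le.1
      · exact (pad_of_lt p hi).symm.trans (not_not.1 (hlast i hji hi))
    · refine ⟨p, le_rfl, fun _ => ⊤, by simp, fun j hj => ?_⟩
      have hpj : coordName p hj = I.val j (I.one j) :=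
        congrArg (I.val j) ((pad_of_lt p hj).symm.trans (not_not.1 (hone j hj)))
      exact hpj ▸ decides_one _ _

end Realization

section Admissible

variable {Q : ι → Type u} [∀ j, Preorder (Q j)] {c : ∀ j, Q j ↪ ZFSet.{u}} {a b : WithTop ι}
  {j : ι} {s t : ∀ j, WithTop (Q j)}

/-- The sequence `s` forces `Q j` to be ccc. As `s` itself need not be realized, this is expressed
in terms of all conditions that realize an extension of `s`. -/
def ForcesCCC (I : FSIteration ι) (c : ∀ j, Q j ↪ ZFSet.{u}) (j : ι) (s : ∀ j, WithTop (Q j)) :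
    Prop :=
  ∀ (p : I.Stage j) (t : ∀ j, WithTop (Q j)), Realizes c p t → LeBelow j t s → checkCCC (c j) p

theorem ForcesCCC.mono (h : ForcesCCC I c j s) (hts : LeBelow j t s) : ForcesCCC I c j t :=
  fun p _ hp hv => h p _ hp (hv.trans hts)

/-- The sequences, up to stage `a`, that occur in the ground model description of `P_a`: they have
finite support and use an element of `Q j` only where `Q j` is forced to be ccc. -/
structure Admissible (I : FSIteration ι) (c : ∀ j, Q j ↪ ZFSet.{u}) (a : WithTop ι)
    (s : ∀ j, WithTop (Q j)) : Prop where
  finite : {j : ι | (j : WithTop ι) < a ∧ s j ≠ ⊤}.Finite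
  forcesCCC : ∀ j : ι, (j : WithTop ι) < a → s j ≠ ⊤ → ForcesCCC I c j s

theorem Admissible.mono (h : Admissible I c a s) (hb : b ≤ a) : Admissible I c b s :=
  ⟨h.finite.subset fun _ hj => ⟨hj.1.trans_le hb, hj.2⟩,
    fun j hj => h.forcesCCC j (hj.trans_le hb)⟩

theorem admissible_top (I : FSIteration ι) (c : ∀ j, Q j ↪ ZFSet.{u}) (a : WithTop ι) :
    Admissible I c a fun _ => ⊤ :=
  ⟨by simp, fun _ _ h => absurd rfl h⟩

theorem Realizes.admissible (hQ : ∀ j, I.UsesIfCCC j (c j)) {p : I.Stage a}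
    (hp : Realizes c p s) : Admissible I c a s :=
  ⟨hp.finite, fun j hj hs _ _ hq hts =>
    checkCCC_mono ((hp.decides j hj).ccc hs) (hq.le hQ (hp.restrict hj.le) hts)⟩

theorem Admissible.exists_realizes (hQ : ∀ j, I.UsesIfCCC j (c j)) (hs : Admissible I c a s) :
    ∃ (p : I.Stage a) (t : _), Realizes c p t ∧ LeBelow a t s := by
  induction a using WellFoundedLT.induction with
  | ind a ih =>
    obtain ⟨j, hj, hsj, hlast⟩ | htop := exists_last_or_forall_not hs.finite
    · obtain ⟨p, t, hpt, hts⟩ := ih j hj (hs.mono hj.le)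
      have hccc : checkCCC (c j) p := hs.forcesCCC j hj hsj p t hpt hts
      obtain ⟨q, hqp, y, hy⟩ := exists_coord_decides (hQ j) (w := s j) fun _ => hccc
      obtain ⟨r, hrq, v, hrv⟩ := exists_realizes_le hQ q
      obtain ⟨v', hrv', -, hv't⟩ := hrv.exists_le hQ hpt (hrq.trans hqp)
      refine ⟨_, _, hrv'.extend (hy.mono hrq) hj, fun i hi => ?_⟩
      rcases lt_trichotomy i j with hij | rfl | hij
      · rw [splice_of_lt _ _ _ _ hij]
        exact hv't.trans hts i (WithTop.coe_lt_coe.2 hij)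
      · rw [splice_self]
      · exact le_top.trans_eq (not_not.1 (hlast i hij hi)).symm
    · obtain ⟨p, -, t, hp⟩ := exists_realizes_le hQ (Classical.arbitrary (I.Stage a))
      exact ⟨p, t, hp, fun j hj => le_top.trans_eq (not_not.1 (htop j hj)).symm⟩

end Admissible

/-! ### The ground model description of an iteration -/

section Approx

variable {ι : Type u} [LinearOrder ι] [WellFoundedLT ι] {I : FSIteration ι}
  {Q : ι → Type u} [∀ j, Preorder (Q j)] {c : ∀ j, Q j ↪ ZFSet.{u}}

/-- The ground model description of the stage `P_a`. -/
def Approx (I : FSIteration ι) (c : ∀ j, Q j ↪ ZFSet.{u}) (a : WithTop ι) : Type u :=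
  {s : ∀ j, WithTop (Q j) // Admissible I c a s}

instance (a : WithTop ι) : Preorder (Approx I c a) where
  le s t := LeBelow a s.1 t.1
  le_refl _ _ _ := le_rfl
  le_trans _ _ _ := LeBelow.trans

/-- The conditions of `P_a` together with a sequence that they realize. This poset is dense both in
`P_a` and in its ground model description. -/
abbrev Realization (I : FSIteration ι) (c : ∀ j, Q j ↪ ZFSet.{u}) (a : WithTop ι) : Type u :=
  {e : I.Stage a × Approx I c a // Realizes c e.1 e.2.1}

variable (hQ : ∀ j, I.UsesIfCCC j (c j))
include hQ

theorem isDenseOrderEmbedding_realization_stage (a : WithTop ι) :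
    IsDenseOrderEmbedding fun e : Realization I c a => e.1.1 where
  mono _ _ h := h.1
  incompat e e' := by
    rw [not_imp_not]
    rintro ⟨r, hre, hre'⟩
    obtain ⟨q, hqr, s, hs⟩ := exists_realizes_le hQ r
    obtain ⟨t, ht, -, hte⟩ := hs.exists_le hQ e.2 (hqr.trans hre)
    obtain ⟨v, hv, hvt, hve'⟩ := ht.exists_le hQ e'.2 (hqr.trans hre')
    exact ⟨⟨(q, ⟨v, hv.admissible hQ⟩), hv⟩, ⟨hqr.trans hre, hvt.trans hte⟩,
      ⟨hqr.trans hre', hve'⟩⟩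
  dense p := by
    obtain ⟨q, hqp, s, hs⟩ := exists_realizes_le hQ p
    exact ⟨⟨(q, ⟨s, hs.admissible hQ⟩), hs⟩, hqp⟩

theorem isDenseOrderEmbedding_realization_approx (a : WithTop ι) :
    IsDenseOrderEmbedding fun e : Realization I c a => e.1.2 where
  mono _ _ h := h.2
  incompat e e' := by
    rw [not_imp_not]
    rintro ⟨s, hse, hse'⟩
    obtain ⟨p, t, hp, hts⟩ := s.2.exists_realizes hQ
    have hte := hts.trans hse
    have hte' := hts.trans hse'
    exact ⟨⟨(p, ⟨t, hp.admissible hQ⟩), hp⟩, ⟨hp.le hQ e.2 hte, hte⟩, ⟨hp.le hQ e'.2 hte', hte'⟩⟩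
  dense s := by
    obtain ⟨p, t, hp, hts⟩ := s.2.exists_realizes hQ
    exact ⟨⟨(p, ⟨t, hp.admissible hQ⟩), hp⟩, hts⟩

theorem forcingEquiv_approx (a : WithTop ι) : ForcingEquiv (I.Stage a) (Approx I c a) :=
  .of_isDenseOrderEmbedding (isDenseOrderEmbedding_realization_stage hQ a)
    (isDenseOrderEmbedding_realization_approx hQ a)

theorem forcesCCC_of_isCCC_prod {j : ι} {s : ∀ j, WithTop (Q j)}
    (h : IsCCC ({t : Approx I c j // LeBelow j t.1 s} × Q j)) : ForcesCCC I c j s := by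
  intro p t hp hts
  have hrealized : ∀ r : Set.Iic p, ∃ q ≤ r.1, ∃ v, Realizes c q v ∧ LeBelow j v s := by
    intro r
    obtain ⟨q, hqr, v, hv⟩ := exists_realizes_le hQ r.1
    obtain ⟨v', hv', -, hvt⟩ := hv.exists_le hQ hp (hqr.trans r.2)
    exact ⟨q, hqr, v', hv', hvt.trans hts⟩
  choose q hq v hv hvs using hrealized
  refine checkCCC_of_isCCC_prod (c j) (h.of_reflects_compat
    (fun i => (⟨⟨v i.1, (hv i.1).admissible hQ⟩, hvs i.1⟩, i.2)) ?_)
  rintro i i' ⟨⟨u, z⟩, hi, hi'⟩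
  obtain ⟨r, w, hr, hwu⟩ := u.1.2.exists_realizes hQ
  have hri : r ≤ i.1.1 := (hr.le hQ (hv i.1) (hwu.trans hi.1)).trans (hq i.1)
  have hri' : r ≤ i'.1.1 := (hr.le hQ (hv i'.1) (hwu.trans hi'.1)).trans (hq i'.1)
  exact ⟨(⟨r, hri.trans i.1.2⟩, z), ⟨hri, hi.2⟩, ⟨hri', hi'.2⟩⟩

end Approx

section FirstCoordinate

variable {ι : Type u} [LinearOrder ι] [WellFoundedLT ι] {I : FSIteration ι}
  {Q : ι → Type u} [∀ j, Preorder (Q j)] {c : ∀ j, Q j ↪ ZFSet.{u}} {a : WithTop ι} {j : ι}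
  {s t : ∀ j, WithTop (Q j)}

theorem Admissible.splice_top (hs : Admissible I c j s) (hj : ForcesCCC I c j s) (w : WithTop (Q j))
    (a : WithTop ι) : Admissible I c a (splice (fun _ => ⊤) s j w) := by
  refine ⟨(finite_splice_ne (hs.finite.subset fun i hi => ?_)).subset fun i hi => hi.2,
    fun i _ hne => ?_⟩
  · exact ⟨WithTop.coe_lt_coe.2 hi.1, hi.2⟩
  have hle : ∀ {k : ι}, k ≤ j → LeBelow k (splice (fun _ => ⊤) s j w) s :=
    fun hk i hi => (splice_of_lt _ _ _ _ ((WithTop.coe_lt_coe.1 hi).trans_le hk)).le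
  rcases lt_trichotomy i j with hij | rfl | hij
  · rw [splice_of_lt _ _ _ _ hij] at hne
    exact (hs.forcesCCC i (WithTop.coe_lt_coe.2 hij) hne).mono (hle hij.le)
  · exact hj.mono (hle le_rfl)
  · exact absurd (splice_of_gt _ _ _ _ hij) hne

variable [OrderBot ι]

/-- The ground model description of the iteration after its first step. -/
def Tail (I : FSIteration ι) (c : ∀ j, Q j ↪ ZFSet.{u}) : Type u :=
  {s : Approx I c ⊤ // s.1 ⊥ = ⊤}

instance : Preorder (Tail I c) := Subtype.preorder _

instance : OrderTop (Tail I c) where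
  top := ⟨⟨_, admissible_top I c ⊤⟩, rfl⟩
  le_top _ _ _ := le_top

instance : OrderTop (Antisymmetrization (Tail I c) (· ≤ ·)) where
  top := toAntisymmetrization _ ⊤
  le_top := Quotient.ind fun s => toAntisymmetrization_mono (le_top (a := s))

theorem forced_checkCCC_bot {X : Type u} [Preorder X] (e : X ↪ ZFSet.{u}) (hX : IsCCC X) :
    Forced (P := I.Stage (⊥ : ι)) (checkCCC e) := by
  intro p
  refine checkCCC_of_isCCC_prod e (hX.of_reflects_compat Prod.snd ?_)
  rintro i i' ⟨z, hi, hi'⟩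
  have hle : ∀ q r : I.Stage (⊥ : ι), q ≤ r := fun q r =>
    le_iff_iterandLE.2 fun k hk => absurd (WithTop.coe_lt_coe.1 hk) not_lt_bot
  exact ⟨(i.1, z), ⟨le_rfl, hi⟩, ⟨hle _ _, hi'⟩⟩

theorem Admissible.update_bot_of_forall {w : WithTop (Q ⊥)}
    (hbot : Forced (P := I.Stage (⊥ : ι)) (checkCCC (c ⊥)))
    (hupd : ∀ i : ι, (i : WithTop ι) < a → ∀ {s}, ForcesCCC I c i s →
      ForcesCCC I c i (Function.update s ⊥ w))
    (hs : Admissible I c a s) : Admissible I c a (Function.update s ⊥ w) := by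
  refine ⟨(hs.finite.insert ⊥).subset fun i hi => ?_, fun i hi hne => ?_⟩ <;>
    obtain rfl | hib := eq_or_ne i ⊥
  · exact .inl rfl
  · exact .inr ⟨hi.1, by simpa only [Function.update_of_ne hib] using hi.2⟩
  · exact fun p _ _ _ => hbot p
  · rw [Function.update_of_ne hib] at hne
    exact hupd i hi (hs.forcesCCC i hi hne)

variable (hQ : ∀ j, I.UsesIfCCC j (c j))
  (hbot : Forced (P := I.Stage (⊥ : ι)) (checkCCC (c ⊥)))

include hQ hbot in
theorem nonempty_bot : Nonempty (Q ⊥) := by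
  obtain ⟨p⟩ : Nonempty (I.Stage (⊥ : ι)) := inferInstance
  obtain ⟨-, -, y, -⟩ := exists_checkElem_of_mem
    ((I.poset ⊥ p).top_mem.congr_right ((hQ ⊥ p).1 p le_rfl (hbot p)).1)
  exact ⟨y⟩

variable (hprod : IsCCC (Approx I c ⊤ × Q ⊥))
include hQ hbot hprod

theorem ForcesCCC.update_bot_of_forall_lt
    (hupd : ∀ i < j, ∀ {s}, ForcesCCC I c i s →
      ∀ w, ForcesCCC I c i (Function.update s ⊥ w))
    (h : ForcesCCC I c j s) (w : WithTop (Q ⊥)) :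
    ForcesCCC I c j (Function.update s ⊥ w) := by
  have hadm : ∀ {t}, Admissible I c j t → ∀ w, Admissible I c j (Function.update t ⊥ w) :=
    fun ht w => ht.update_bot_of_forall hbot fun i hi _ h => hupd i (WithTop.coe_lt_coe.1 hi) h w
  have hsplice : ∀ e : {t : Approx I c j // LeBelow j t.1 (Function.update s ⊥ w)}, ∀ y : Q j,
      Admissible I c ⊤ (splice (fun _ => ⊤) (Function.update e.1.1 ⊥ (s ⊥)) j y) :=
    fun e y => (hadm e.1.2 (s ⊥)).splice_top (h.mono (e.2.update_of_update le_rfl)) y ⊤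
  obtain ⟨x₀⟩ := nonempty_bot hQ hbot
  -- `t ⊥` moves to the second factor and `s ⊥` takes its place.
  refine forcesCCC_of_isCCC_prod hQ (hprod.of_reflects_compat
    (fun e => (⟨_, hsplice e.1 e.2⟩, (e.1.1.1 ⊥).untopD x₀)) ?_)
  rintro ⟨t, y⟩ ⟨t', y'⟩ ⟨⟨u, x⟩, hu, hu'⟩
  have hle : ∀ (t : Approx I c j) (y : WithTop (Q j)), x ≤ (t.1 ⊥).untopD x₀ →
      LeBelow ⊤ u.1 (splice (fun _ => ⊤) (Function.update t.1 ⊥ (s ⊥)) j y) →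
      LeBelow j (Function.update u.1 ⊥ ↑x) t.1 ∧ u.1 j ≤ y := fun t y hx hu =>
    ⟨hu.of_splice.update_of_update ((WithTop.coe_le_coe.2 hx).trans (WithTop.coe_untopD_le _ _)),
      (hu j (WithTop.coe_lt_top j)).trans_eq (splice_self ..)⟩
  obtain ⟨ht, hy⟩ := hle t.1 y hu.2 hu.1
  obtain ⟨ht', hy'⟩ := hle t'.1 y' hu'.2 hu'.1
  obtain ⟨z, hz, hzy⟩ := WithTop.le_coe_iff.1 hy
  exact ⟨(⟨⟨_, hadm (u.2.mono le_top) x⟩, ht.trans t.2⟩, z), ⟨ht, hzy⟩,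
    ⟨ht', WithTop.coe_le_coe.1 (hz ▸ hy')⟩⟩

theorem ForcesCCC.update_bot (h : ForcesCCC I c j s) (w : WithTop (Q ⊥)) :
    ForcesCCC I c j (Function.update s ⊥ w) := by
  induction j using WellFoundedLT.induction generalizing s w with
  | ind j ih => exact h.update_bot_of_forall_lt hQ hbot hprod (fun i hi _ h w => ih i hi h w) w

theorem Admissible.update_bot (hs : Admissible I c a s) (w : WithTop (Q ⊥)) :
    Admissible I c a (Function.update s ⊥ w) :=
  hs.update_bot_of_forall hbot fun _ _ _ h => h.update_bot hQ hbot hprod w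

theorem exists_isDenseOrderEmbedding_prod_tail :
    ∃ e : Q ⊥ × Tail I c → Approx I c ⊤, IsDenseOrderEmbedding e := by
  obtain ⟨x₀⟩ := nonempty_bot hQ hbot
  have hadm := fun (s : Approx I c ⊤) => s.2.update_bot hQ hbot hprod
  refine ⟨fun i => ⟨_, hadm i.2.1 i.1⟩, .of_le_of_le (fun i i' h => ?_)
    (fun u => ((u.1 ⊥).untopD x₀, ⟨⟨_, hadm u ⊤⟩, Function.update_self ..⟩))
    (fun u i h => ⟨?_, ?_⟩) (fun u => ?_)⟩
  · refine LeBelow.update_of_update (w := i'.2.1.1 ⊥) ?_ ?_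
    · rw [Function.update_idem, Function.update_eq_self]
      exact h.2
    · simpa only [Function.update_self] using WithTop.coe_le_coe.2 h.1
  · have hbot := (h ⊥ (WithTop.coe_lt_top _)).trans_eq (Function.update_self ..)
    obtain ⟨x, hx, hxi⟩ := WithTop.le_coe_iff.1 hbot
    rwa [hx]
  · exact h.update_of_update i.2.2.ge
  · exact LeBelow.update_of_update (fun _ _ => le_rfl) (WithTop.coe_untopD_le _ _)

end FirstCoordinate

end FSIteration

theorem mainTheorem12 {ι : Type u} [LinearOrder ι] [WellFoundedLT ι] [OrderBot ι]
    (I : FSIteration ι) (hI : IsCCC (I.Stage ⊤))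
    (Q : ι → Type u) [∀ j, Preorder (Q j)] (c : ∀ j, Q j ↪ ZFSet.{u})
    (hQ : ∀ j, I.UsesIfCCC j (c j))
    (hQ₀ : Forced (P := I.Stage ⊤) (FStmt.checkCCC (c ⊥))) :
    ∃ (Pbar : Type u) (_ : PartialOrder Pbar) (_ : OrderTop Pbar),
      ForcingEquiv (I.Stage ⊤) (Q ⊥ × Pbar) := by
  have hprod : IsCCC (I.Stage ⊤ × Q ⊥) := FStmt.isCCC_prod_of_forced (c ⊥) hI hQ₀
  have hbot : Forced (P := I.Stage (⊥ : ι)) (FStmt.checkCCC (c ⊥)) :=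
    FSIteration.forced_checkCCC_bot (c ⊥) hprod.of_prod_right
  have happrox := FSIteration.forcingEquiv_approx hQ ⊤
  obtain ⟨e, he⟩ := FSIteration.exists_isDenseOrderEmbedding_prod_tail hQ hbot
    (happrox.isCCC_prod hprod)
  refine ⟨Antisymmetrization (FSIteration.Tail I c) (· ≤ ·), inferInstance, inferInstance, ?_⟩
  exact (happrox.comp_right he).comp_right
    ((isDenseOrderEmbedding_ofAntisymmetrization _).prodMap_id (Q ⊥))
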